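/- Let $N,m\ge 1$ and let $T_1,\dots,T_m$ be non-singular linear maps on $\mathbb R^N$ with $\|T_i\|<1$. For a linear map $T$ with singular values $\alpha_1\ge\dots\ge\alpha_N$ put $\phi^s(T)=\alpha_1\cdots\alpha_{j-1}\alpha_j^{\,s-j+1}$ if $0<s\le N$ and $j$ is the integer with $j-1<s\le j$, and $\phi^s(T)=(\alpha_1\cdots\alpha_N)^{s/N}$ if $s>N$. For a finite word $u=(u_1,\dots,u_k)$ over $\{1,\dots,m\}$ write $|u|=k$ and $T_u=T_{u_1}\cdots T_{u_k}$, and let $C_u$ be the set of all infinite words in $I_\infty=\{1,\dots,m\}^{\mathbb N}$ that begin with $u$. For distinct $x,y\in I_\infty$ let $x\wedge y$ be their longest common initial word. The join set of distinct $x_1,\dots,x_r\in I_\infty$ consists of the words $x_a\wedge x_b$ $(a\ne b)$, where $v$ is counted with multiplicity $t-1$, $t$ being the largest number of words among the $x_a$ whose pairwise joins all equal $v$; it has $r-1$ elements $v_1,\dots,v_{r-1}$, counted with multiplicity, and we put $\phi^s(x_1,\dots,x_r)=\phi^s(T_{v_1})\cdots\phi^s(T_{v_{r-1}})$. If the $x_a$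 are not distinct, put $\phi^s(x_1,\dots,x_r)=0$ and $\phi^s(x_1,\dots,x_r)^{-1}=\infty$. Let $\mu$ be a finite Borel measure on $I_\infty$, let $q>1$, and let $n$ be an integer with $q-1\le n\le q$. Let $s>0$ be such that $\sum_{|u|=k}\phi^s(T_u)^{1-q}\mu(C_u)^q$ decays geometrically in $k$, that is, there are $c>0$ and $0<\lambda<1$ with $$\sum_{|u|=k}\phi^s(T_u)^{1-q}\mu(C_u)^q\le c\lambda^k\qquad\text{for all }k\ge 0.$$ Then $$\int\Big[\int\cdots\int\phi^s(i_1,\dots,i_n,j)^{-1}\,d\mu(i_1)\cdots d\mu(i_n)\Big]^{(q-1)/n}d\mu(j)<\infty .$$ -/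

import Mathlib

open MeasureTheory
open scoped ENNReal

noncomputable section

namespace AlmostSelfAffine

/-- The singular value function `φ^s(T)` of a linear map `T` on `ℝ^N`. Mathlib's singular values
are listed in decreasing order and indexed from `0`, so that `α_i(T)` is `singularValues (i - 1)`.
For `0 < s ≤ N` and `j = ⌈s⌉` (so `j - 1 < s ≤ j`) it is `α_1 ⋯ α_{j-1} α_j^{s-j+1}`; for `s > N`
it is `(α_1 ⋯ α_N)^{s/N}`. -/
def svf {N : ℕ} (s : ℝ) (T : EuclideanSpace ℝ (Fin N) →L[ℝ] EuclideanSpace ℝ (Fin N)) : ℝ :=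
  if s ≤ 0 then 1
  else if s ≤ N then
    (∏ i ∈ Finset.range (⌈s⌉₊ - 1), T.toLinearMap.singularValues i) *
      T.toLinearMap.singularValues (⌈s⌉₊ - 1) ^ (s - (⌈s⌉₊ : ℝ) + 1)
  else (∏ i ∈ Finset.range N, T.toLinearMap.singularValues i) ^ (s / (N : ℝ))

/-- The code space `I_∞` of infinite words over the alphabet `{1, …, m}`; its (product) σ-algebra
is the Borel σ-algebra. -/
abbrev Code (m : ℕ) : Type := ℕ → Fin m

/-- The finite words over the alphabet `{1, …, m}`. -/
abbrev Word (m : ℕ) : Type := List (Fin m)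

/-- The curtailment `x|_k = (x_1, …, x_k)` of an infinite word. -/
def curtail {m : ℕ} (x : Code m) (k : ℕ) : Word m := List.ofFn fun i : Fin k => x i

/-- The cylinder `C_u` of all infinite words that begin with `u`. -/
def cyl {m : ℕ} (u : Word m) : Set (Code m) := {x | curtail x u.length = u}

/-- The product `T_u = T_{u_1} T_{u_2} ⋯ T_{u_k}`, the identity if `u` is empty. -/
def wordMap {N m : ℕ} (T : Fin m → EuclideanSpace ℝ (Fin N) →L[ℝ] EuclideanSpace ℝ (Fin N))
    (u : Word m) : EuclideanSpace ℝ (Fin N) →L[ℝ] EuclideanSpace ℝ (Fin N) :=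
  (u.map T).prod

/-- The moment sum `∑_{|u| = k} φ^s(T_u)^{1-q} μ(C_u)^q`. -/
def momentSum {N m : ℕ} (T : Fin m → EuclideanSpace ℝ (Fin N) →L[ℝ] EuclideanSpace ℝ (Fin N))
    (μ : Measure (Code m)) (s q : ℝ) (k : ℕ) : ℝ :=
  ∑ u : Fin k → Fin m,
    svf s (wordMap T (List.ofFn u)) ^ (1 - q) * μ.real (cyl (List.ofFn u)) ^ q

/-- The join `x ∧ y`, the longest common initial word of two distinct infinite words. (The join of
two equal infinite words is not a finite word; this function is used only for distinct ones.) -/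
def join {m : ℕ} (x y : Code m) : Word m := curtail x (PiNat.firstDiff x y)

open Classical in
/-- The set of the join points `x_p ∧ x_q`, `p ≠ q`, of distinct infinite words, without
multiplicities. -/
def joinPoints {m n : ℕ} (x : Fin n → Code m) : Finset (Word m) :=
  (Finset.univ.filter fun p : Fin n × Fin n => p.1 ≠ p.2).image fun p => join (x p.1) (x p.2)

open Classical in
/-- The multiplicity `r - 1` of a join point `v`, where `r` is the greatest number of words among
the `x_p` whose pairwise joins all equal `v`. -/
def joinMult {m n : ℕ} (x : Fin n → Code m) (v : Word m) : ℕ :=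
  (Finset.univ.filter fun A : Finset (Fin n) =>
    ∀ p ∈ A, ∀ q ∈ A, p ≠ q → join (x p) (x q) = v).sup Finset.card - 1

open Classical in
/-- The multienergy kernel `φ^s(x_1, …, x_n)`, the product of `φ^s(T_v)` over the join set of
`x_1, …, x_n`, counted with multiplicity. If two of the words coincide, then their join is an
infinite word, along which `φ^s(T_v)` tends to `0`, and the kernel is `0`. -/
def multiKernel {N m n : ℕ} (T : Fin m → EuclideanSpace ℝ (Fin N) →L[ℝ] EuclideanSpace ℝ (Fin N))
    (s : ℝ) (x : Fin n → Code m) : ℝ :=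
  if Function.Injective x then ∏ v ∈ joinPoints x, svf s (wordMap T v) ^ joinMult x v else 0

/-- The multienergy integral
`∫ [∫ ⋯ ∫ φ^s(i_1, …, i_n, j)⁻¹ dμ(i_1) ⋯ dμ(i_n)]^{(q-1)/n} dμ(j)`, with values in `[0, ∞]`;
the integrand is `∞` where the kernel vanishes. -/
def multiEnergy {N m : ℕ} (T : Fin m → EuclideanSpace ℝ (Fin N) →L[ℝ] EuclideanSpace ℝ (Fin N))
    (μ : Measure (Code m)) (s q : ℝ) (n : ℕ) : ℝ≥0∞ :=
  ∫⁻ j, (∫⁻ i : Fin n → Code m,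
      (ENNReal.ofReal (multiKernel T s (Fin.snoc (α := fun _ => Code m) i j)))⁻¹
        ∂(Measure.pi fun _ => μ)) ^ ((q - 1) / (n : ℝ)) ∂μ

end AlmostSelfAffine

end

/-!
Attaching the words one at a time, each at its longest join with those already present, bounds
`φ^s(i_1, …, i_n, j)⁻¹` by a sum over trees on the words of products over the edges of the
two-word kernel `∑ φ^s(T_u)⁻¹`, where `u` runs through the common prefixes. The integral over a
leaf of the tree is then a potential, which becomes a density at the neighbouring word. By Jensen's
inequality on cylinders and the geometric decay of the moment sums, the potential of a density
`≤ H ^ a`, with `H` integrable and `a ≤ 1`, is at most `C * H' ^ (a + 1 / (q - 1))` with `H'`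
integrable. So after `n` integrations the inner integral is at most `C * H ^ (n / (q - 1))`, which
raised to the power `(q - 1) / n` is integrable. The exponents fed into Jensen's inequality are at
most `(n - 1) / (q - 1) ≤ 1`.
-/

noncomputable section

namespace AlmostSelfAffine

section LIntegral

variable {α : Type*} [MeasurableSpace α] {μ : Measure α}

theorem laverage_rpow_le (μ : Measure α) {H : α → ℝ≥0∞} (hH : AEMeasurable H μ) {a : ℝ}
    (ha₀ : 0 ≤ a) (ha₁ : a ≤ 1) : ⨍⁻ x, H x ^ a ∂μ ≤ (⨍⁻ x, H x ∂μ) ^ a := by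
  have hν : ((μ Set.univ)⁻¹ • μ) Set.univ ≤ 1 := by
    simp [ENNReal.inv_mul_le_one]
  have hölder := ENNReal.lintegral_mul_norm_pow_le (hH.smul_measure (μ Set.univ)⁻¹)
    (aemeasurable_const (b := (1 : ℝ≥0∞))) ha₀ (sub_nonneg.2 ha₁) (add_sub_cancel a 1)
  simp only [ENNReal.one_rpow, mul_one, lintegral_one] at hölder
  exact hölder.trans (mul_le_of_le_one_right' (ENNReal.rpow_le_one hν (sub_nonneg.2 ha₁)))

theorem setLIntegral_rpow_le {H : α → ℝ≥0∞} {S : Set α} (hH : AEMeasurable H (μ.restrict S))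
    {a : ℝ} (ha₀ : 0 ≤ a) (ha₁ : a ≤ 1) (hS : μ S ≠ ⊤) :
    ∫⁻ x in S, H x ^ a ∂μ ≤ μ S * (⨍⁻ x in S, H x ∂μ) ^ a := by
  rw [← measure_mul_setLAverage _ hS]
  gcongr
  exact laverage_rpow_le _ hH ha₀ ha₁

theorem lintegral_pi_succ (μ : Measure α) [SigmaFinite μ] {n : ℕ}
    {f : (Fin (n + 1) → α) → ℝ≥0∞} (hf : Measurable f) :
    ∫⁻ x, f x ∂(Measure.pi fun _ => μ) =
      ∫⁻ x : Fin n → α, ∫⁻ y, f (Fin.cons y x) ∂μ ∂(Measure.pi fun _ => μ) := by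
  have hcons := (measurePreserving_piFinSuccAbove (fun _ : Fin (n + 1) => μ) 0).symm
  rw [← hcons.lintegral_comp hf, lintegral_prod_symm
    (fun z => f ((MeasurableEquiv.piFinSuccAbove (fun _ => α) 0).symm z))
    (hf.comp hcons.measurable).aemeasurable]
  simp [MeasurableEquiv.piFinSuccAbove, Fin.insertNthEquiv]

theorem measurable_snoc {n : ℕ} (y : α) :
    Measurable fun x : Fin n → α => (Fin.snoc (α := fun _ => α) x y : Fin (n + 1) → α) := by
  refine measurable_pi_lambda _ fun a => ?_
  cases a using Fin.lastCases with
  | last => simp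
  | cast b => simpa using measurable_pi_apply b

theorem tsum_geometric_ne_top {θ : ℝ≥0∞} (hθ : θ < 1) : ∑' k, θ ^ k ≠ ⊤ := by
  rw [ENNReal.tsum_geometric]
  exact ENNReal.inv_ne_top.2 (tsub_pos_of_lt hθ).ne'

theorem exists_integrable_geometric_majorant {f : ℕ → α → ℝ≥0∞} (hf : ∀ k, Measurable (f k))
    {c ρ τ : ℝ≥0∞} (hc : c ≠ ⊤) (hρτ : ρ < τ) (hτ : τ ≠ ⊤)
    (hfρ : ∀ k, ∫⁻ x, f k x ∂μ ≤ c * ρ ^ k) :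
    ∃ M : α → ℝ≥0∞, Measurable M ∧ ∫⁻ x, M x ∂μ ≠ ⊤ ∧ ∀ k x, f k x ≤ τ ^ k * M x := by
  have hτ₀ : τ ≠ 0 := hρτ.ne_bot
  have hterm : ∀ k, Measurable fun x => (τ⁻¹) ^ k * f k x := fun k => (hf k).const_mul _
  refine ⟨fun x => ∑' k, (τ⁻¹) ^ k * f k x, Measurable.tsum hterm, ?_, fun k x => ?_⟩
  · have hratio : ρ * τ⁻¹ < 1 := by
      rw [← div_eq_mul_inv]
      exact ENNReal.div_lt_of_lt_mul (by rwa [one_mul])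
    rw [lintegral_tsum fun k => (hterm k).aemeasurable]
    refine ne_top_of_le_ne_top (ENNReal.mul_ne_top hc (tsum_geometric_ne_top hratio)) ?_
    rw [← ENNReal.tsum_mul_left]
    refine ENNReal.tsum_le_tsum fun k => ?_
    calc ∫⁻ x, (τ⁻¹) ^ k * f k x ∂μ = (τ⁻¹) ^ k * ∫⁻ x, f k x ∂μ := lintegral_const_mul _ (hf k)
      _ ≤ (τ⁻¹) ^ k * (c * ρ ^ k) := by gcongr; exact hfρ k
      _ = c * (ρ * τ⁻¹) ^ k := by ring
  · calc f k x = τ ^ k * ((τ⁻¹) ^ k * f k x) := by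
          rw [← mul_assoc, ← mul_pow, ENNReal.mul_inv_cancel hτ₀ hτ, one_pow, one_mul]
      _ ≤ τ ^ k * ∑' k, (τ⁻¹) ^ k * f k x := by gcongr; exact ENNReal.le_tsum k

end LIntegral

section DominatedByPower

variable {α : Type*} [MeasurableSpace α] {μ : Measure α} {a b : ℝ} {F G : α → ℝ≥0∞}

/-- `F` is measurable and at most a constant multiple of `H ^ a` for some integrable `H`. For
`a > 0` this is membership of `L^(1/a)`, and for `a = 0` it is boundedness; stated by domination,
the exponents simply add up under products. -/
def DominatedByPower (μ : Measure α) (a : ℝ) (F : α → ℝ≥0∞) : Prop :=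
  Measurable F ∧ ∃ C : ℝ≥0∞, C ≠ ⊤ ∧ ∃ H : α → ℝ≥0∞, Measurable H ∧ ∫⁻ x, H x ∂μ ≠ ⊤ ∧
    ∀ x, F x ≤ C * H x ^ a

namespace DominatedByPower

theorem measurable (hF : DominatedByPower μ a F) : Measurable F := hF.1

theorem mono (hF : DominatedByPower μ a F) (hG : Measurable G) {C : ℝ≥0∞} (hC : C ≠ ⊤)
    (hGF : ∀ x, G x ≤ C * F x) : DominatedByPower μ a G := by
  obtain ⟨-, D, hD, H, hH, hHi, hFH⟩ := hF
  refine ⟨hG, C * D, ENNReal.mul_ne_top hC hD, H, hH, hHi, fun x => (hGF x).trans ?_⟩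
  rw [mul_assoc]
  gcongr
  exact hFH x

theorem one : DominatedByPower μ 0 (1 : α → ℝ≥0∞) :=
  ⟨measurable_const, 1, ENNReal.one_ne_top, 0, measurable_zero, by simp, by simp⟩

theorem zero : DominatedByPower μ a (0 : α → ℝ≥0∞) :=
  ⟨measurable_const, 0, ENNReal.zero_ne_top, 0, measurable_zero, by simp, by simp⟩

theorem rpow {H : α → ℝ≥0∞} (hH : Measurable H) (hHi : ∫⁻ x, H x ∂μ ≠ ⊤) (a : ℝ) :
    DominatedByPower μ a fun x => H x ^ a :=
  ⟨hH.pow_const a, 1, ENNReal.one_ne_top, H, hH, hHi, fun _ => (one_mul _).ge⟩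

theorem exists_common_majorant (ha : 0 ≤ a) (hb : 0 ≤ b) (hF : DominatedByPower μ a F)
    (hG : DominatedByPower μ b G) :
    ∃ C D : ℝ≥0∞, C ≠ ⊤ ∧ D ≠ ⊤ ∧ ∃ H : α → ℝ≥0∞, Measurable H ∧ ∫⁻ x, H x ∂μ ≠ ⊤ ∧
      (∀ x, F x ≤ C * H x ^ a) ∧ ∀ x, G x ≤ D * H x ^ b := by
  obtain ⟨-, C, hC, H, hH, hHi, hFH⟩ := hF
  obtain ⟨-, D, hD, J, hJ, hJi, hGJ⟩ := hG
  refine ⟨C, D, hC, hD, fun x => H x + J x, hH.add hJ, ?_, fun x => (hFH x).trans ?_,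
    fun x => (hGJ x).trans ?_⟩
  · rw [lintegral_add_left hH]
    exact ENNReal.add_ne_top.2 ⟨hHi, hJi⟩
  · gcongr
    exact le_self_add
  · gcongr
    exact le_add_self

theorem mul (ha : 0 ≤ a) (hb : 0 ≤ b) (hF : DominatedByPower μ a F)
    (hG : DominatedByPower μ b G) : DominatedByPower μ (a + b) (F * G) := by
  obtain ⟨C, D, hC, hD, H, hH, hHi, hFH, hGH⟩ := hF.exists_common_majorant ha hb hG
  refine ⟨hF.measurable.mul hG.measurable, C * D, ENNReal.mul_ne_top hC hD, H, hH, hHi,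
    fun x => (mul_le_mul' (hFH x) (hGH x)).trans_eq ?_⟩
  rw [ENNReal.rpow_add_of_nonneg _ _ ha hb]
  ring

theorem add (ha : 0 ≤ a) (hF : DominatedByPower μ a F) (hG : DominatedByPower μ a G) :
    DominatedByPower μ a (F + G) := by
  obtain ⟨C, D, hC, hD, H, hH, hHi, hFH, hGH⟩ := hF.exists_common_majorant ha ha hG
  exact ⟨hF.measurable.add hG.measurable, C + D, ENNReal.add_ne_top.2 ⟨hC, hD⟩, H, hH, hHi,
    fun x => (add_le_add (hFH x) (hGH x)).trans_eq (add_mul _ _ _).symm⟩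

theorem sum (ha : 0 ≤ a) {ι : Type*} (S : Finset ι) {F : ι → α → ℝ≥0∞}
    (hF : ∀ i ∈ S, DominatedByPower μ a (F i)) : DominatedByPower μ a (∑ i ∈ S, F i) :=
  Finset.sum_induction F (DominatedByPower μ a) (fun _ _ => add ha) zero hF

theorem lintegral_rpow_inv_lt_top (ha : 0 < a) (hF : DominatedByPower μ a F) :
    ∫⁻ x, F x ^ a⁻¹ ∂μ < ⊤ := by
  obtain ⟨-, C, hC, H, hH, hHi, hFH⟩ := hF
  have ha' : 0 ≤ a⁻¹ := (inv_pos.2 ha).le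
  calc ∫⁻ x, F x ^ a⁻¹ ∂μ ≤ ∫⁻ x, C ^ a⁻¹ * H x ∂μ := lintegral_mono fun x => by
        calc F x ^ a⁻¹ ≤ (C * H x ^ a) ^ a⁻¹ := ENNReal.rpow_le_rpow (hFH x) ha'
          _ = C ^ a⁻¹ * H x := by
            rw [ENNReal.mul_rpow_of_nonneg _ _ ha', ENNReal.rpow_rpow_inv ha.ne']
    _ = C ^ a⁻¹ * ∫⁻ x, H x ∂μ := lintegral_const_mul _ hH
    _ < ⊤ := ENNReal.mul_lt_top (ENNReal.rpow_lt_top_of_nonneg ha' hC) hHi.lt_top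

end DominatedByPower

theorem dominatedByPower_tsum_mul_rpow {p : ℝ} (hp : 0 < p) (ha : 0 ≤ a)
    {A E : ℕ → α → ℝ≥0∞} (hA : ∀ k, Measurable (A k)) (hE : ∀ k, Measurable (E k))
    {c d r : ℝ≥0∞} (hc : c ≠ ⊤) (hd : d ≠ ⊤) (hr : r < 1)
    (hAr : ∀ k, ∫⁻ x, A k x ^ p ∂μ ≤ c * r ^ k) (hEd : ∀ k, ∫⁻ x, E k x ∂μ ≤ d) :
    DominatedByPower μ (p⁻¹ + a) fun x => ∑' k, A k x * E k x ^ a := by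
  have hpa : 0 < (1 + a) * p := by positivity
  -- The decay of `A k ^ p` at rate `r` pays for a loss of `θ⁻¹ ^ k` in the bound on `E k`.
  obtain ⟨θ, hrθ, hθ₁⟩ := exists_between (ENNReal.rpow_lt_one hr (inv_pos.2 hpa))
  have hθ₀ : θ ≠ 0 := hrθ.ne_bot
  have hθ : θ ≠ ⊤ := hθ₁.ne_top
  obtain ⟨M, hM, hMi, hAM⟩ := exists_integrable_geometric_majorant
    (fun k => (hA k).pow_const p) hc ((ENNReal.rpow_inv_lt_iff hpa).1 hrθ)
    (ENNReal.rpow_ne_top_of_nonneg hpa.le hθ) hAr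
  obtain ⟨M', hM', hMi', hEM'⟩ := exists_integrable_geometric_majorant hE hd
    (ENNReal.one_lt_inv.2 hθ₁) (ENNReal.inv_ne_top.2 hθ₀) (by simpa using hEd)
  have hAx : ∀ k x, A k x ≤ (θ ^ k) ^ (1 + a) * M x ^ p⁻¹ := fun k x => by
    rw [← ENNReal.rpow_rpow_inv hp.ne' (A k x)]
    refine (ENNReal.rpow_le_rpow (hAM k x) (by positivity)).trans_eq ?_
    rw [ENNReal.mul_rpow_of_nonneg _ _ (by positivity), ENNReal.rpow_mul,
      ← ENNReal.rpow_natCast, ← ENNReal.rpow_mul, ← ENNReal.rpow_natCast, ← ENNReal.rpow_mul,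
      ← ENNReal.rpow_mul, ← ENNReal.rpow_mul]
    congr 2
    field_simp
  have hEx : ∀ k x, E k x ^ a ≤ (θ ^ k) ^ (-a) * M' x ^ a := fun k x => by
    refine (ENNReal.rpow_le_rpow (hEM' k x) ha).trans_eq ?_
    rw [ENNReal.mul_rpow_of_nonneg _ _ ha, ← ENNReal.inv_pow, ENNReal.inv_rpow,
      ENNReal.rpow_neg]
  refine ((DominatedByPower.rpow hM hMi p⁻¹).mul (by positivity) ha (.rpow hM' hMi' a)).mono
    (Measurable.tsum fun k => (hA k).mul ((hE k).pow_const a)) (tsum_geometric_ne_top hθ₁)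
    fun x => ?_
  rw [← ENNReal.tsum_mul_right]
  refine ENNReal.tsum_le_tsum fun k => ?_
  calc A k x * E k x ^ a
      ≤ (θ ^ k) ^ (1 + a) * M x ^ p⁻¹ * ((θ ^ k) ^ (-a) * M' x ^ a) :=
        mul_le_mul' (hAx k x) (hEx k x)
    _ = (θ ^ k) ^ (1 + a) * (θ ^ k) ^ (-a) * (M x ^ p⁻¹ * M' x ^ a) := by ring
    _ = θ ^ k * (M x ^ p⁻¹ * M' x ^ a) := by
        rw [← ENNReal.rpow_add _ _ (pow_ne_zero k hθ₀) (ENNReal.pow_ne_top hθ),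
          add_neg_cancel_right, ENNReal.rpow_one]

end DominatedByPower

section TreeWeight

variable {α : Type*} {K : α → α → ℝ≥0∞} {n : ℕ}

/-- The product over the labels `a < n` of the sums over `b > a` of `K (x a) (x b)`. Expanded, it
is a sum over the trees on the labels that are rooted at the last one and have increasing
branches. -/
def treeWeight (K : α → α → ℝ≥0∞) : (n : ℕ) → (Fin (n + 1) → α) → ℝ≥0∞
  | 0, _ => 1
  | n + 1, x => (∑ b : Fin (n + 1), K (x 0) (x b.succ)) * treeWeight K n (Fin.tail x)

theorem treeWeight_ne_zero (hK : ∀ x y, K x y ≠ 0) (x : Fin (n + 1) → α) :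
    treeWeight K n x ≠ 0 := by
  induction n with
  | zero => exact one_ne_zero
  | succ n ih => exact mul_ne_zero (by simp [hK]) (ih _)

theorem treeWeight_eq_top_of_not_injective (hK : ∀ x y, K x y ≠ 0) (hK' : ∀ x, K x x = ⊤)
    {x : Fin (n + 1) → α} (hx : ¬ Function.Injective x) : treeWeight K n x = ⊤ := by
  induction n with
  | zero => exact absurd (Function.injective_of_subsingleton (α := Fin 1) x) hx
  | succ n ih =>
    rw [treeWeight]
    by_cases hmem : x 0 ∈ Set.range (Fin.tail x)
    · obtain ⟨b, hb⟩ := hmem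
      have hsum : ∑ b : Fin (n + 1), K (x 0) (x b.succ) = ⊤ :=
        ENNReal.sum_eq_top.2 ⟨b, Finset.mem_univ b, (congrArg (K (x 0)) hb).trans (hK' _)⟩
      rw [hsum, ENNReal.top_mul (treeWeight_ne_zero hK _)]
    · have htail : ¬ Function.Injective (Fin.tail x) := fun h =>
        hx (Fin.cons_self_tail x ▸ Fin.cons_injective_iff.2 ⟨hmem, h⟩)
      rw [ih htail, ENNReal.mul_top (by simp [hK])]

theorem prod_mulSingle_apply (b : Fin n) (P : α → ℝ≥0∞) (x : Fin n → α) :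
    ∏ a, (Pi.mulSingle b P : Fin n → α → ℝ≥0∞) a (x a) = P (x b) := by
  rw [Fintype.prod_eq_single b fun a hab => by rw [Pi.mulSingle_eq_of_ne hab, Pi.one_apply],
    Pi.mulSingle_eq_same]

variable [MeasurableSpace α] {μ : Measure α} {F : Fin (n + 1) → α → ℝ≥0∞}

theorem measurable_treeWeight (hK : Measurable fun z : α × α => K z.1 z.2) (n : ℕ) :
    Measurable (treeWeight K n) := by
  induction n with
  | zero => exact measurable_const
  | succ n ih =>
    have hpair : ∀ b : Fin (n + 1), Measurable fun x : Fin (n + 2) → α => (x 0, x b.succ) :=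
      fun b => (measurable_pi_apply 0).prodMk (measurable_pi_apply b.succ)
    exact (Finset.measurable_fun_sum _ fun b _ => hK.comp (hpair b)).mul
      (ih.comp (measurable_pi_lambda _ fun a => measurable_pi_apply a.succ))

theorem measurable_prod_mul_treeWeight (hK : Measurable fun z : α × α => K z.1 z.2)
    (hF : ∀ a, Measurable (F a)) :
    Measurable fun x : Fin (n + 1) → α => (∏ a, F a (x a)) * treeWeight K n x :=
  (Finset.measurable_fun_prod _ fun a _ => (hF a).comp (measurable_pi_apply a)).mul
    (measurable_treeWeight hK n)

/-- The potential of the density `F` with respect to the kernel `K` and the measure `μ`. -/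
def potential (K : α → α → ℝ≥0∞) (μ : Measure α) (F : α → ℝ≥0∞) (x : α) : ℝ≥0∞ :=
  ∫⁻ y, F y * K y x ∂μ

theorem lintegral_cons_prod_mul_treeWeight (hK : Measurable fun z : α × α => K z.1 z.2)
    {F : Fin (n + 2) → α → ℝ≥0∞} (hF : Measurable (F 0)) (x : Fin (n + 1) → α) :
    ∫⁻ y, (∏ a, F a ((Fin.cons y x : Fin (n + 2) → α) a)) *
        treeWeight K (n + 1) (Fin.cons y x : Fin (n + 2) → α) ∂μ =
      ∑ b, (∏ a, (Fin.tail F * Pi.mulSingle b (potential K μ (F 0)) : Fin (n + 1) → α → ℝ≥0∞)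
        a (x a)) * treeWeight K n x := by
  have hFK : ∀ b, Measurable fun y => F 0 y * K y (x b) := fun b =>
    hF.mul (hK.comp (measurable_id.prodMk measurable_const))
  have hfactor : ∀ y, (∏ a, F a ((Fin.cons y x : Fin (n + 2) → α) a)) *
        treeWeight K (n + 1) (Fin.cons y x : Fin (n + 2) → α) =
      (∑ b, F 0 y * K y (x b)) * ((∏ a, Fin.tail F a (x a)) * treeWeight K n x) := fun y => by
    rw [Fin.prod_univ_succ, treeWeight, ← Finset.mul_sum]
    simp only [Fin.cons_zero, Fin.cons_succ, Fin.tail_cons, Fin.tail]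
    ring
  simp_rw [hfactor]
  rw [lintegral_mul_const _ (Finset.measurable_fun_sum _ fun b _ => hFK b),
    lintegral_finsetSum _ fun b _ => hFK b, Finset.sum_mul]
  refine Finset.sum_congr rfl fun b _ => ?_
  simp only [Pi.mul_apply, Finset.prod_mul_distrib, prod_mulSingle_apply, potential]
  ring

/-- The integral of `treeWeight K n` against the densities `F a` over all labels but the last
one, as a function of the point at the last label. -/
def treeIntegral (K : α → α → ℝ≥0∞) (μ : Measure α) (n : ℕ) (F : Fin (n + 1) → α → ℝ≥0∞)
    (y : α) : ℝ≥0∞ :=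
  ∫⁻ x : Fin n → α, (∏ a, F a ((Fin.snoc (α := fun _ => α) x y : Fin (n + 1) → α) a)) *
    treeWeight K n (Fin.snoc (α := fun _ => α) x y) ∂(Measure.pi fun _ => μ)

theorem treeIntegral_succ [SigmaFinite μ] (hK : Measurable fun z : α × α => K z.1 z.2)
    {F : Fin (n + 2) → α → ℝ≥0∞} (hF : ∀ a, Measurable (F a))
    (hF' : Measurable (potential K μ (F 0))) :
    treeIntegral K μ (n + 1) F =
      ∑ b, treeIntegral K μ n (Fin.tail F * Pi.mulSingle b (potential K μ (F 0))) := by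
  have hgraft : ∀ b a, Measurable
      ((Fin.tail F * Pi.mulSingle b (potential K μ (F 0)) : Fin (n + 1) → α → ℝ≥0∞) a) := by
    intro b a
    refine (hF a.succ).mul ?_
    rcases eq_or_ne a b with rfl | hab
    · rwa [Pi.mulSingle_eq_same]
    · rw [Pi.mulSingle_eq_of_ne hab]
      exact measurable_one
  ext y
  rw [Finset.sum_apply]
  refine Eq.trans (lintegral_pi_succ μ
    ((measurable_prod_mul_treeWeight hK hF).comp (measurable_snoc y))) ?_
  refine Eq.trans (lintegral_congr fun x => ?_) (lintegral_finsetSum _ fun b _ =>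
    (measurable_prod_mul_treeWeight hK (hgraft b)).comp (measurable_snoc y))
  simp only [← Fin.cons_snoc_eq_snoc_cons, lintegral_cons_prod_mul_treeWeight hK (hF 0)]

/-- If forming the potential raises the exponent of domination by `δ`, then each of the `n`
integrations contributes `δ`. -/
theorem DominatedByPower.treeIntegral [SigmaFinite μ]
    (hK : Measurable fun z : α × α => K z.1 z.2) {δ : ℝ} (hδ : 0 ≤ δ)
    (hpot : ∀ {a : ℝ} {F : α → ℝ≥0∞}, 0 ≤ a → a ≤ 1 → DominatedByPower μ a F →
      DominatedByPower μ (δ + a) (potential K μ F))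
    {e : Fin (n + 1) → ℝ} (he₀ : ∀ a, 0 ≤ e a) (he : n * δ + ∑ a, e a ≤ δ + 1)
    (hF : ∀ a, DominatedByPower μ (e a) (F a)) :
    DominatedByPower μ (n * δ + ∑ a, e a) (treeIntegral K μ n F) := by
  induction n with
  | zero =>
    have : AlmostSelfAffine.treeIntegral K μ 0 F = F 0 := by
      ext y
      simp [AlmostSelfAffine.treeIntegral, treeWeight, Fin.snoc]
    simpa [this] using hF 0
  | succ n ih =>
    have hsum : ((n + 1 : ℕ) : ℝ) * δ + ∑ a, e a =
        n * δ + (δ + e 0 + ∑ a : Fin (n + 1), e a.succ) := by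
      rw [Fin.sum_univ_succ]
      push_cast
      ring
    have htail₀ : 0 ≤ ∑ a : Fin (n + 1), e a.succ := Finset.sum_nonneg fun a _ => he₀ _
    have hP : DominatedByPower μ (δ + e 0) (potential K μ (F 0)) := by
      have : 0 ≤ n * δ := by positivity
      exact hpot (he₀ 0) (by linarith) (hF 0)
    rw [treeIntegral_succ hK (fun a => (hF a).measurable) hP.measurable]
    refine DominatedByPower.sum (add_nonneg (by positivity) (Finset.sum_nonneg fun a _ => he₀ a))
      _ fun b _ => ?_
    have hgraft : ((n + 1 : ℕ) : ℝ) * δ + ∑ a, e a =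
        n * δ + ∑ a, (Fin.tail e + Pi.single b (δ + e 0) : Fin (n + 1) → ℝ) a := by
      simp only [hsum, Pi.add_apply, Finset.sum_add_distrib, Fintype.sum_pi_single', Fin.tail]
      ring
    rw [hgraft] at he ⊢
    refine ih (fun a => ?_) he fun a => ?_
    · have hsingle : (0 : Fin (n + 1) → ℝ) ≤ Pi.single b (δ + e 0) :=
        Pi.single_nonneg.2 (add_nonneg hδ (he₀ 0))
      exact add_nonneg (he₀ _) (hsingle a)
    · rcases eq_or_ne a b with rfl | hab
      · simpa [Fin.tail] using (hF a.succ).mul (he₀ _) (add_nonneg hδ (he₀ 0)) hP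
      · simpa [Fin.tail, hab] using hF a.succ

end TreeWeight

section Words

variable {m k : ℕ} {x y : Code m} {v : Word m}

@[simp]
theorem length_curtail (x : Code m) (k : ℕ) : (curtail x k).length = k :=
  List.length_ofFn

@[simp]
theorem length_join (x y : Code m) : (join x y).length = PiNat.firstDiff x y :=
  length_curtail x _

theorem mem_cyl_ofFn {f : Fin k → Fin m} : x ∈ cyl (List.ofFn f) ↔ (fun i : Fin k => x i) = f := by
  rw [← List.ofFn_inj]
  change curtail x (List.ofFn f).length = _ ↔ curtail x k = _
  rw [List.length_ofFn]

theorem mem_cyl_curtail : y ∈ cyl (curtail x k) ↔ curtail y k = curtail x k :=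
  mem_cyl_ofFn.trans List.ofFn_inj.symm

theorem cyl_curtail (x : Code m) (k : ℕ) : cyl (curtail x k) = PiNat.cylinder x k := by
  ext y
  exact mem_cyl_ofFn.trans (funext_iff.trans Fin.forall_iff)

theorem mem_cyl_iff_le_firstDiff (hxy : x ≠ y) (hx : x ∈ cyl v) :
    y ∈ cyl v ↔ v.length ≤ PiNat.firstDiff x y := by
  rw [← PiNat.mem_cylinder_iff_le_firstDiff hxy, PiNat.mem_cylinder_comm, ← cyl_curtail, hx]

theorem join_eq_iff (hxy : x ≠ y) :
    join x y = v ↔ x ∈ cyl v ∧ y ∈ cyl v ∧ x v.length ≠ y v.length := by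
  constructor
  · rintro rfl
    have hx : x ∈ cyl (join x y) := mem_cyl_curtail.2 rfl
    exact ⟨hx, (mem_cyl_iff_le_firstDiff hxy hx).2 (length_join x y).le,
      length_join x y ▸ PiNat.apply_firstDiff_ne hxy⟩
  · rintro ⟨hx, hy, hne⟩
    have hle := (mem_cyl_iff_le_firstDiff hxy hx).1 hy
    have hlen : PiNat.firstDiff x y = v.length :=
      le_antisymm (not_lt.1 fun hlt => hne (PiNat.apply_eq_of_lt_firstDiff hlt)) hle
    rw [join, hlen, hx]

end Words

section JoinSet

variable {m n : ℕ} {x : Fin n → Code m} {v : Word m}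

open Classical in
/-- The letters which follow `v` in those of the words `x p` that begin with `v`. Words with
pairwise joins `v` are words that continue `v` with distinct letters, so the multiplicity of `v` in
the join set is the number of these letters minus one. -/
def branches (x : Fin n → Code m) (v : Word m) : Finset (Fin m) :=
  (Finset.univ.filter fun p => x p ∈ cyl v).image fun p => x p v.length

theorem mem_branches {l : Fin m} : l ∈ branches x v ↔ ∃ p, x p ∈ cyl v ∧ x p v.length = l := by
  simp [branches]

theorem card_le_card_branches (hx : Function.Injective x) {A : Finset (Fin n)}
    (hA : ∀ p ∈ A, ∀ q ∈ A, p ≠ q → join (x p) (x q) = v) (hA' : 1 < A.card) :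
    A.card ≤ (branches x v).card := by
  have hjoin : ∀ p ∈ A, ∀ q ∈ A, p ≠ q → x p ∈ cyl v ∧ x q ∈ cyl v ∧
      x p v.length ≠ x q v.length := fun p hp q hq hpq =>
    (join_eq_iff (hx.ne hpq)).1 (hA p hp q hq hpq)
  refine Finset.card_le_card_of_injOn (fun p => x p v.length) (fun p hp => ?_)
    fun p hp q hq heq => by_contra fun hpq => (hjoin p hp q hq hpq).2.2 heq
  obtain ⟨q, hq, hqp⟩ := Finset.exists_mem_ne hA' p
  exact mem_branches.2 ⟨p, (hjoin p hp q hq hqp.symm).1, rfl⟩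

theorem exists_card_eq_card_branches (hx : Function.Injective x) (v : Word m) :
    ∃ A : Finset (Fin n), (∀ p ∈ A, ∀ q ∈ A, p ≠ q → join (x p) (x q) = v) ∧
      A.card = (branches x v).card := by
  classical
  have hsurj : Set.SurjOn (fun p => x p v.length) {p | x p ∈ cyl v} (branches x v) :=
    fun l hl => mem_branches.1 hl
  obtain ⟨A, hA, hinj, himage⟩ := Finset.exists_subset_injOn_image_eq_of_surjOn _ _ hsurj
  refine ⟨A, fun p hp q hq hpq => ?_, by rw [← himage, Finset.card_image_of_injOn hinj]⟩
  exact (join_eq_iff (hx.ne hpq)).2 ⟨hA hp, hA hq, fun heq => hpq (hinj hp hq heq)⟩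

theorem joinMult_eq_card_branches_sub_one (hx : Function.Injective x) (v : Word m) :
    joinMult x v = (branches x v).card - 1 := by
  classical
  obtain ⟨A, hA, hcard⟩ := exists_card_eq_card_branches hx v
  unfold joinMult
  set S := Finset.univ.filter fun A : Finset (Fin n) =>
    ∀ p ∈ A, ∀ q ∈ A, p ≠ q → join (x p) (x q) = v
  have hge : (branches x v).card ≤ S.sup Finset.card :=
    hcard ▸ Finset.le_sup (f := Finset.card) (by simpa [S] using hA)
  have hle : S.sup Finset.card ≤ max 1 (branches x v).card := Finset.sup_le fun B hB => by
    rcases le_or_gt B.card 1 with hB₁ | hB₁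
    · exact le_max_of_le_left hB₁
    · exact le_max_of_le_right (card_le_card_branches hx (by simpa [S] using hB) hB₁)
  omega

theorem joinMult_eq_zero (hx : Function.Injective x) (hv : v ∉ joinPoints x) :
    joinMult x v = 0 := by
  rw [joinMult_eq_card_branches_sub_one hx, Nat.sub_eq_zero_iff_le, Finset.card_le_one]
  intro l hl l' hl'
  obtain ⟨p, hp, rfl⟩ := mem_branches.1 hl
  obtain ⟨q, hq, rfl⟩ := mem_branches.1 hl'
  by_contra hne
  have hpq : p ≠ q := fun h => hne (h ▸ rfl)
  refine hv (Finset.mem_image.2 ⟨(p, q), by simpa using hpq, ?_⟩)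
  exact (join_eq_iff (hx.ne hpq)).2 ⟨hp, hq, hne⟩

theorem joinPoints_tail_subset (x : Fin (n + 1) → Code m) :
    joinPoints (Fin.tail x) ⊆ joinPoints x := by
  intro v
  simp only [joinPoints, Finset.mem_image, Finset.mem_filter, Finset.mem_univ, true_and,
    Prod.exists]
  rintro ⟨p, q, hpq, hv⟩
  exact ⟨p.succ, q.succ, (Fin.succ_injective _).ne hpq, hv⟩

theorem branches_of_notMem_cyl {x : Fin (n + 1) → Code m} (hv : x 0 ∉ cyl v) :
    branches x v = branches (Fin.tail x) v := by
  ext l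
  simp [mem_branches, Fin.exists_fin_succ, hv, Fin.tail]

theorem branches_of_mem_cyl {x : Fin (n + 1) → Code m} (hv : x 0 ∈ cyl v) :
    branches x v = insert (x 0 v.length) (branches (Fin.tail x) v) := by
  ext l
  simp [mem_branches, Fin.exists_fin_succ, hv, Fin.tail, eq_comm]

/-- Among the letters following a prefix `v` of `x 0`, that of `x 0` is new exactly for those `v`
that are at least as long as the longest join of `x 0` with another word. -/
theorem joinMult_succ {x : Fin (n + 2) → Code m} (hx : Function.Injective x) {b : Fin (n + 1)}
    (hb : ∀ c : Fin (n + 1), PiNat.firstDiff (x 0) (x c.succ) ≤ PiNat.firstDiff (x 0) (x b.succ))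
    (v : Word m) :
    joinMult x v = joinMult (Fin.tail x) v + if v = join (x 0) (x b.succ) then 1 else 0 := by
  have hne : ∀ c : Fin (n + 1), x 0 ≠ x c.succ := fun c => hx.ne (Fin.succ_ne_zero c).symm
  rw [joinMult_eq_card_branches_sub_one hx,
    joinMult_eq_card_branches_sub_one (x := Fin.tail x) (hx.comp (Fin.succ_injective _))]
  by_cases hv : x 0 ∈ cyl v
  swap
  · rw [branches_of_notMem_cyl hv, if_neg, add_zero]
    rintro rfl
    exact hv (mem_cyl_curtail.2 rfl)
  have htail : ∀ c : Fin (n + 1), Fin.tail x c ∈ cyl v ↔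
      v.length ≤ PiNat.firstDiff (x 0) (x c.succ) := fun c => mem_cyl_iff_le_firstDiff (hne c) hv
  rw [branches_of_mem_cyl hv]
  rcases lt_trichotomy v.length (PiNat.firstDiff (x 0) (x b.succ)) with hlt | heq | hgt
  · have hold : x 0 v.length ∈ branches (Fin.tail x) v := mem_branches.2
      ⟨b, (htail b).2 hlt.le, (PiNat.apply_eq_of_lt_firstDiff hlt).symm⟩
    rw [Finset.insert_eq_of_mem hold, if_neg, add_zero]
    rintro rfl
    exact hlt.ne (length_join _ _)
  · have hjoin : v = join (x 0) (x b.succ) := by rw [join, ← heq, hv]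
    have hnew : x 0 v.length ∉ branches (Fin.tail x) v := by
      rw [mem_branches]
      rintro ⟨c, hc, hletter⟩
      have hlen := heq.trans_ge (hb c) |>.antisymm ((htail c).1 hc)
      exact PiNat.apply_firstDiff_ne (hne c) (hlen ▸ hletter.symm)
    have hpos : 0 < (branches (Fin.tail x) v).card :=
      Finset.card_pos.2 ⟨_, mem_branches.2 ⟨b, (htail b).2 heq.le, rfl⟩⟩
    rw [Finset.card_insert_of_notMem hnew, if_pos hjoin]
    omega
  · have hempty : branches (Fin.tail x) v = ∅ := by
      refine Finset.eq_empty_of_forall_notMem fun l hl => ?_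
      obtain ⟨c, hc, -⟩ := mem_branches.1 hl
      exact (((htail c).1 hc).trans (hb c)).not_gt hgt
    rw [hempty, if_neg]
    · simp
    rintro rfl
    exact hgt.ne' (length_join _ _)

/-- The product of `φ v` over the join set of the words `x p`, counted with multiplicity. -/
def joinProd {M : Type*} [CommMonoid M] (φ : Word m → M) (x : Fin n → Code m) : M :=
  ∏ v ∈ joinPoints x, φ v ^ joinMult x v

theorem joinProd_fin_one {M : Type*} [CommMonoid M] (φ : Word m → M) (x : Fin 1 → Code m) :
    joinProd φ x = 1 := by
  simp [joinProd, joinPoints, Subsingleton.elim (α := Fin 1) _ 0]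

theorem joinProd_eq_prod {M : Type*} [CommMonoid M] (φ : Word m → M) (hx : Function.Injective x)
    {S : Finset (Word m)} (hS : joinPoints x ⊆ S) :
    joinProd φ x = ∏ v ∈ S, φ v ^ joinMult x v :=
  Finset.prod_subset hS fun v _ hv => by rw [joinMult_eq_zero hx hv, pow_zero]

theorem joinProd_succ {M : Type*} [CommMonoid M] (φ : Word m → M) {x : Fin (n + 2) → Code m}
    (hx : Function.Injective x) {b : Fin (n + 1)}
    (hb : ∀ c : Fin (n + 1), PiNat.firstDiff (x 0) (x c.succ) ≤ PiNat.firstDiff (x 0) (x b.succ)) :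
    joinProd φ x = φ (join (x 0) (x b.succ)) * joinProd φ (Fin.tail x) := by
  classical
  have hmem : join (x 0) (x b.succ) ∈ joinPoints x :=
    Finset.mem_image.2 ⟨(0, b.succ), by simp [(Fin.succ_ne_zero b).symm], rfl⟩
  rw [joinProd_eq_prod φ (x := Fin.tail x) (hx.comp (Fin.succ_injective _))
    (joinPoints_tail_subset x), joinProd]
  simp only [joinMult_succ hx hb, pow_add, Finset.prod_mul_distrib, pow_ite, pow_one, pow_zero,
    Finset.prod_ite_eq', if_pos hmem]
  exact mul_comm _ _

end JoinSet

section PathKernel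

variable {m n : ℕ} {h : Word m → ℝ≥0∞}

theorem measurable_comp_curtail₂ {β : Type*} [MeasurableSpace β] (f : Word m → Word m → β)
    (k : ℕ) : Measurable fun x : Code m × Code m => f (curtail x.1 k) (curtail x.2 k) := by
  have hrestrict : Measurable fun (x : Code m) (i : Fin k) => x i :=
    measurable_pi_lambda _ fun i => measurable_pi_apply _
  exact (Measurable.of_discrete
    (f := fun u : (Fin k → Fin m) × (Fin k → Fin m) => f (List.ofFn u.1) (List.ofFn u.2))).comp
    ((hrestrict.comp measurable_fst).prodMk (hrestrict.comp measurable_snd))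

theorem measurable_comp_curtail {β : Type*} [MeasurableSpace β] (f : Word m → β) (k : ℕ) :
    Measurable fun x : Code m => f (curtail x k) :=
  (measurable_comp_curtail₂ (fun u _ => f u) k).comp (measurable_id.prodMk measurable_id)

theorem measurableSet_cyl (u : Word m) : MeasurableSet (cyl u) :=
  measurableSet_setOfPred.2 (measurable_comp_curtail (fun v => v = u) u.length)

/-- The sum of `h` over the common finite initial words of `x` and `y`. It dominates `h` at the join
of `x` and `y`, and as an integral kernel it splits over the generations of cylinders. -/
def pathKernel (h : Word m → ℝ≥0∞) (x y : Code m) : ℝ≥0∞ :=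
  ∑' k, if curtail x k = curtail y k then h (curtail x k) else 0

theorem measurable_pathKernel (h : Word m → ℝ≥0∞) :
    Measurable fun z : Code m × Code m => pathKernel h z.1 z.2 :=
  Measurable.tsum fun k => measurable_comp_curtail₂ (fun u v => if u = v then h u else 0) k

theorem apply_join_le_pathKernel (h : Word m → ℝ≥0∞) (x y : Code m) :
    h (join x y) ≤ pathKernel h x y := by
  have hprefix : curtail x (PiNat.firstDiff x y) = curtail y (PiNat.firstDiff x y) := by
    rw [← mem_cyl_curtail, cyl_curtail]
    exact PiNat.mem_cylinder_firstDiff x y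
  refine le_trans (le_of_eq ?_) (ENNReal.le_tsum (PiNat.firstDiff x y))
  rw [if_pos hprefix, join]

theorem pathKernel_ne_zero (hh : ∀ u, h u ≠ 0) (x y : Code m) : pathKernel h x y ≠ 0 :=
  ((pos_iff_ne_zero.2 (hh _)).trans_le (apply_join_le_pathKernel h x y)).ne'

theorem pathKernel_self (hh : ∀ u, 1 ≤ h u) (x : Code m) : pathKernel h x x = ⊤ := by
  refine top_unique ?_
  calc (⊤ : ℝ≥0∞) = ∑' _ : ℕ, 1 := (ENNReal.tsum_const_eq_top_of_ne_zero one_ne_zero).symm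
    _ ≤ pathKernel h x x := ENNReal.tsum_le_tsum fun k => by simpa using hh _

theorem joinProd_le_treeWeight (h : Word m → ℝ≥0∞) {x : Fin (n + 1) → Code m}
    (hx : Function.Injective x) : joinProd h x ≤ treeWeight (pathKernel h) n x := by
  induction n with
  | zero => exact (joinProd_fin_one h x).le
  | succ n ih =>
    obtain ⟨b, hb⟩ := Finite.exists_max fun c : Fin (n + 1) => PiNat.firstDiff (x 0) (x c.succ)
    rw [joinProd_succ h hx hb, treeWeight]
    refine mul_le_mul' ?_ (ih (hx.comp (Fin.succ_injective _)))
    exact (apply_join_le_pathKernel h _ _).trans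
      (Finset.single_le_sum_of_canonicallyOrdered (f := fun c : Fin (n + 1) =>
        pathKernel h (x 0) (x c.succ)) (Finset.mem_univ b))

end PathKernel

section Potential

variable {m : ℕ} {h : Word m → ℝ≥0∞} {μ : Measure (Code m)} {F : Code m → ℝ≥0∞}

theorem lintegral_comp_curtail (μ : Measure (Code m)) (f : Word m → ℝ≥0∞) (k : ℕ) :
    ∫⁻ x, f (curtail x k) ∂μ =
      ∑ u : Fin k → Fin m, f (List.ofFn u) * μ (cyl (List.ofFn u)) := by
  have hrestrict : Measurable fun (x : Code m) (i : Fin k) => x i :=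
    measurable_pi_lambda _ fun i => measurable_pi_apply _
  have hpreimage : ∀ u : Fin k → Fin m,
      (fun (x : Code m) (i : Fin k) => x i) ⁻¹' {u} = cyl (List.ofFn u) := fun u =>
    Set.ext fun x => mem_cyl_ofFn.symm
  calc ∫⁻ x, f (curtail x k) ∂μ
      = ∫⁻ u, f (List.ofFn u) ∂μ.map fun (x : Code m) (i : Fin k) => x i :=
        (lintegral_map (Measurable.of_discrete (f := fun u => f (List.ofFn u))) hrestrict).symm
    _ = ∑ u : Fin k → Fin m, f (List.ofFn u) * μ (cyl (List.ofFn u)) := by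
        simp only [lintegral_fintype, Measure.map_apply hrestrict (measurableSet_singleton _),
          hpreimage]

theorem lintegral_setLAverage_cyl_le (μ : Measure (Code m)) [IsFiniteMeasure μ]
    (H : Code m → ℝ≥0∞) (k : ℕ) :
    ∫⁻ x, ⨍⁻ y in cyl (curtail x k), H y ∂μ ∂μ ≤ ∫⁻ y, H y ∂μ := by
  have hpartition := lintegral_comp_curtail (μ.withDensity H) 1 k
  simp only [Pi.one_apply, lintegral_one, one_mul, withDensity_apply _ (measurableSet_cyl _),
    withDensity_apply _ MeasurableSet.univ, Measure.restrict_univ] at hpartition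
  rw [lintegral_comp_curtail μ (fun u => ⨍⁻ y in cyl u, H y ∂μ), hpartition]
  simp only [mul_comm _ (μ _), measure_mul_setLAverage H (measure_ne_top μ _), le_refl]

theorem potential_pathKernel_eq_tsum (hF : Measurable F) (x : Code m) :
    potential (pathKernel h) μ F x =
      ∑' k, h (curtail x k) * ∫⁻ y in cyl (curtail x k), F y ∂μ := by
  have hterm : ∀ k y, F y * (if curtail y k = curtail x k then h (curtail y k) else 0) =
      (cyl (curtail x k)).indicator (fun y => h (curtail x k) * F y) y := fun k y => by
    by_cases hy : curtail y k = curtail x k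
    · rw [if_pos hy, Set.indicator_of_mem (mem_cyl_curtail.2 hy), hy, mul_comm]
    · rw [if_neg hy, Set.indicator_of_notMem (hy ∘ mem_cyl_curtail.1), mul_zero]
  simp only [potential, pathKernel, ← ENNReal.tsum_mul_left, hterm]
  rw [lintegral_tsum fun k => ((hF.const_mul _).indicator (measurableSet_cyl _)).aemeasurable]
  simp only [lintegral_indicator (measurableSet_cyl _), lintegral_const_mul _ hF]

theorem DominatedByPower.potential_pathKernel [IsFiniteMeasure μ] {p : ℝ} (hp : 0 < p)
    {c r : ℝ≥0∞} (hc : c ≠ ⊤) (hr : r < 1)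
    (hdecay : ∀ k, ∫⁻ x, (h (curtail x k) * μ (cyl (curtail x k))) ^ p ∂μ ≤ c * r ^ k)
    {a : ℝ} (ha₀ : 0 ≤ a) (ha₁ : a ≤ 1) (hF : DominatedByPower μ a F) :
    DominatedByPower μ (p⁻¹ + a) (potential (pathKernel h) μ F) := by
  obtain ⟨hFm, C, hC, H, hH, hHi, hFH⟩ := hF
  have hcyl : ∀ x k, h (curtail x k) * ∫⁻ y in cyl (curtail x k), F y ∂μ ≤
      C * (h (curtail x k) * μ (cyl (curtail x k)) *
        (⨍⁻ y in cyl (curtail x k), H y ∂μ) ^ a) := fun x k =>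
    calc h (curtail x k) * ∫⁻ y in cyl (curtail x k), F y ∂μ
        ≤ h (curtail x k) * ∫⁻ y in cyl (curtail x k), C * H y ^ a ∂μ := by
          gcongr
          exact hFH _
      _ = C * (h (curtail x k) * ∫⁻ y in cyl (curtail x k), H y ^ a ∂μ) := by
          rw [lintegral_const_mul _ (hH.pow_const a), mul_left_comm]
      _ ≤ C * (h (curtail x k) * (μ (cyl (curtail x k)) *
            (⨍⁻ y in cyl (curtail x k), H y ∂μ) ^ a)) := by
          gcongr
          exact setLIntegral_rpow_le hH.aemeasurable ha₀ ha₁ (measure_ne_top μ _)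
      _ = _ := by rw [← mul_assoc (h _)]
  have hpot : potential (pathKernel h) μ F = fun x =>
      ∑' k, h (curtail x k) * ∫⁻ y in cyl (curtail x k), F y ∂μ :=
    funext (potential_pathKernel_eq_tsum hFm)
  refine (dominatedByPower_tsum_mul_rpow hp ha₀
    (fun k => measurable_comp_curtail (fun u => h u * μ (cyl u)) k)
    (fun k => measurable_comp_curtail (fun u => ⨍⁻ y in cyl u, H y ∂μ) k)
    hc hHi hr hdecay (lintegral_setLAverage_cyl_le μ H)).mono ?_ hC fun x => ?_
  · rw [hpot]
    exact Measurable.tsum fun k =>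
      measurable_comp_curtail (fun u => h u * ∫⁻ y in cyl u, F y ∂μ) k
  · rw [hpot, ← ENNReal.tsum_mul_left]
    exact ENNReal.tsum_le_tsum (hcyl x)

end Potential

section TreeIntegralPathKernel

variable {m : ℕ} {h : Word m → ℝ≥0∞} {μ : Measure (Code m)} [IsFiniteMeasure μ]

theorem dominatedByPower_treeIntegral_pathKernel {p : ℝ} (hp : 0 < p) {c r : ℝ≥0∞} (hc : c ≠ ⊤)
    (hr : r < 1)
    (hdecay : ∀ k, ∫⁻ x, (h (curtail x k) * μ (cyl (curtail x k))) ^ p ∂μ ≤ c * r ^ k)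
    {n : ℕ} (hn : n ≤ p + 1) :
    DominatedByPower μ (n * p⁻¹) (treeIntegral (pathKernel h) μ n 1) := by
  have hexp : n * p⁻¹ + ∑ a : Fin (n + 1), (0 : Fin (n + 1) → ℝ) a ≤ p⁻¹ + 1 := by
    simp only [Pi.zero_apply, Finset.sum_const_zero, add_zero]
    calc n * p⁻¹ ≤ (p + 1) * p⁻¹ := by gcongr
      _ = p⁻¹ + 1 := by rw [add_mul, mul_inv_cancel₀ hp.ne', one_mul, add_comm]
  simpa using DominatedByPower.treeIntegral (F := 1) (e := 0) (measurable_pathKernel h)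
    (inv_nonneg.2 hp.le) (fun ha₀ ha₁ => .potential_pathKernel hp hc hr hdecay ha₀ ha₁)
    (fun _ => le_rfl) hexp fun _ => .one

end TreeIntegralPathKernel

section SingularValues

open Module in
theorem singularValues_le_opNorm {𝕜 E F : Type*} [RCLike 𝕜] [NormedAddCommGroup E]
    [InnerProductSpace 𝕜 E] [FiniteDimensional 𝕜 E] [NormedAddCommGroup F]
    [InnerProductSpace 𝕜 F] [FiniteDimensional 𝕜 F] (T : E →L[𝕜] F) (i : ℕ) :
    T.toLinearMap.singularValues i ≤ ‖T‖ := by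
  rcases lt_or_ge i (finrank 𝕜 E) with hi | hi
  · obtain ⟨v, hv⟩ :=
      (T.toLinearMap.hasEigenvalue_adjoint_comp_self_sq_singularValues hi).exists_hasEigenvector
    have hTv : ‖T v‖ ^ 2 = (T.toLinearMap.singularValues i * ‖v‖) ^ 2 := by
      have hinner : inner 𝕜 (T v) (T v) =
          inner 𝕜 v ((LinearMap.adjoint T.toLinearMap ∘ₗ T.toLinearMap) v) := by
        rw [LinearMap.comp_apply, LinearMap.adjoint_inner_right, ContinuousLinearMap.coe_coe]
      rw [hv.apply_eq_smul, inner_smul_right, inner_self_eq_norm_sq_to_K,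
        inner_self_eq_norm_sq_to_K] at hinner
      rw [mul_pow]
      exact_mod_cast hinner
    have hle : T.toLinearMap.singularValues i * ‖v‖ ≤ ‖T‖ * ‖v‖ :=
      (le_of_sq_le_sq hTv.ge (norm_nonneg _)).trans (T.le_opNorm v)
    exact le_of_mul_le_mul_right hle (norm_pos_iff.2 hv.2)
  · rw [LinearMap.singularValues_of_finrank_le _ hi]
    exact norm_nonneg _

variable {N m : ℕ}

theorem svf_le_one {s : ℝ} {T : EuclideanSpace ℝ (Fin N) →L[ℝ] EuclideanSpace ℝ (Fin N)}
    (hT : ‖T‖ ≤ 1) : svf s T ≤ 1 := by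
  have h₀ := T.toLinearMap.singularValues_nonneg
  have h₁ : ∀ i, T.toLinearMap.singularValues i ≤ 1 :=
    fun i => (singularValues_le_opNorm T i).trans hT
  have hprod : ∀ k, ∏ i ∈ Finset.range k, T.toLinearMap.singularValues i ≤ 1 :=
    fun k => Finset.prod_le_one (fun i _ => h₀ i) fun i _ => h₁ i
  unfold svf
  split_ifs with hs hsN
  · exact le_rfl
  · have hexp : 0 ≤ s - ⌈s⌉₊ + 1 := by linarith [Nat.ceil_lt_add_one (not_le.1 hs).le]
    exact mul_le_one₀ (hprod _) (Real.rpow_nonneg (h₀ _) _) (Real.rpow_le_one (h₀ _) (h₁ _) hexp)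
  · exact Real.rpow_le_one (Finset.prod_nonneg fun i _ => h₀ i) (hprod _)
      (div_nonneg (not_le.1 hs).le N.cast_nonneg)

theorem svf_pos (s : ℝ) {T : EuclideanSpace ℝ (Fin N) →L[ℝ] EuclideanSpace ℝ (Fin N)}
    (hT : Function.Injective T) : 0 < svf s T := by
  have hpos : ∀ i < N, 0 < T.toLinearMap.singularValues i := by
    simpa using T.toLinearMap.injective_iff_forall_lt_finrank_singularValues_pos.1 hT
  unfold svf
  split_ifs with hs hsN
  · exact one_pos
  · have hceil : ⌈s⌉₊ - 1 < N := by
      have := Nat.ceil_pos.2 (not_le.1 hs)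
      have := Nat.ceil_le.2 hsN
      omega
    exact mul_pos (Finset.prod_pos fun i hi => hpos i ((Finset.mem_range.1 hi).trans hceil))
      (Real.rpow_pos_of_pos (hpos _ hceil) _)
  · exact Real.rpow_pos_of_pos (Finset.prod_pos fun i hi => hpos i (Finset.mem_range.1 hi)) _

variable {T : Fin m → EuclideanSpace ℝ (Fin N) →L[ℝ] EuclideanSpace ℝ (Fin N)}

theorem norm_wordMap_le_one (hT : ∀ i, ‖T i‖ ≤ 1) (u : Word m) : ‖wordMap T u‖ ≤ 1 := by
  refine List.prod_induction (fun A => ‖A‖ ≤ 1)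
    (fun A B hA hB => (norm_mul_le A B).trans (mul_le_one₀ hA (norm_nonneg B) hB))
    ContinuousLinearMap.norm_id_le fun A hA => ?_
  obtain ⟨i, -, rfl⟩ := List.mem_map.1 hA
  exact hT i

theorem wordMap_injective (hT : ∀ i, (T i).det ≠ 0) (u : Word m) :
    Function.Injective (wordMap T u) := by
  refine List.prod_induction (fun A : EuclideanSpace ℝ (Fin N) →L[ℝ] EuclideanSpace ℝ (Fin N) =>
    Function.Injective A) (fun A B hA hB => hA.comp hB) Function.injective_id fun A hA => ?_
  obtain ⟨i, -, rfl⟩ := List.mem_map.1 hA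
  exact (LinearMap.equivOfDetNeZero (T i).toLinearMap (hT i)).injective

theorem svf_wordMap_pos (hT : ∀ i, (T i).det ≠ 0) (s : ℝ) (u : Word m) :
    0 < svf s (wordMap T u) :=
  svf_pos s (wordMap_injective hT u)

end SingularValues

section MultiEnergy

variable {N m n : ℕ} {T : Fin m → EuclideanSpace ℝ (Fin N) →L[ℝ] EuclideanSpace ℝ (Fin N)}
  {μ : Measure (Code m)} {s q : ℝ}

/-- The reciprocal `φ^s(T_u)⁻¹` in `[0, ∞]`. -/
def invSvf (T : Fin m → EuclideanSpace ℝ (Fin N) →L[ℝ] EuclideanSpace ℝ (Fin N)) (s : ℝ)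
    (u : Word m) : ℝ≥0∞ :=
  (ENNReal.ofReal (svf s (wordMap T u)))⁻¹

theorem one_le_invSvf (hT : ∀ i, ‖T i‖ ≤ 1) (s : ℝ) (u : Word m) : 1 ≤ invSvf T s u :=
  ENNReal.one_le_inv.2 (ENNReal.ofReal_le_one.2 (svf_le_one (norm_wordMap_le_one hT u)))

theorem inv_ofReal_joinProd {φ : Word m → ℝ} (hφ : ∀ u, 0 < φ u) (x : Fin n → Code m) :
    (ENNReal.ofReal (joinProd φ x))⁻¹ = joinProd (fun u => (ENNReal.ofReal (φ u))⁻¹) x := by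
  unfold joinProd
  rw [ENNReal.ofReal_prod_of_nonneg fun v _ => (pow_pos (hφ v) _).le,
    ENNReal.prod_inv_distrib fun v _ w _ _ => .inr ENNReal.ofReal_ne_top]
  simp only [ENNReal.ofReal_pow (hφ _).le, ENNReal.inv_pow]

theorem inv_multiKernel_le_treeWeight (hT : ∀ i, ‖T i‖ ≤ 1) (hT' : ∀ i, (T i).det ≠ 0) (s : ℝ)
    (x : Fin (n + 1) → Code m) :
    (ENNReal.ofReal (multiKernel T s x))⁻¹ ≤ treeWeight (pathKernel (invSvf T s)) n x := by
  have hone := one_le_invSvf hT s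
  by_cases hx : Function.Injective x
  · calc (ENNReal.ofReal (multiKernel T s x))⁻¹
        = (ENNReal.ofReal (joinProd (fun u => svf s (wordMap T u)) x))⁻¹ := by
          rw [multiKernel, if_pos hx, joinProd]
      _ = joinProd (invSvf T s) x := inv_ofReal_joinProd (svf_wordMap_pos hT' s) x
      _ ≤ treeWeight (pathKernel (invSvf T s)) n x := joinProd_le_treeWeight _ hx
  · have hne : ∀ y z, pathKernel (invSvf T s) y z ≠ 0 :=
      pathKernel_ne_zero fun u => (one_pos.trans_le (hone u)).ne'
    rw [treeWeight_eq_top_of_not_injective hne (pathKernel_self hone) hx]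
    exact le_top

theorem multiEnergy_le_lintegral_treeIntegral (hT : ∀ i, ‖T i‖ ≤ 1) (hT' : ∀ i, (T i).det ≠ 0)
    (μ : Measure (Code m)) (s : ℝ) (hq : 1 ≤ q) (n : ℕ) :
    multiEnergy T μ s q n ≤
      ∫⁻ y, treeIntegral (pathKernel (invSvf T s)) μ n 1 y ^ ((q - 1) / n) ∂μ := by
  refine lintegral_mono fun y => ENNReal.rpow_le_rpow (lintegral_mono fun x => ?_)
    (div_nonneg (sub_nonneg.2 hq) n.cast_nonneg)
  simpa using inv_multiKernel_le_treeWeight hT hT' s (Fin.snoc (α := fun _ => Code m) x y)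

theorem invSvf_mul_rpow_mul {u : Word m} (hu : 0 < svf s (wordMap T u)) (hq : 1 ≤ q)
    [IsFiniteMeasure μ] (S : Set (Code m)) :
    (invSvf T s u * μ S) ^ (q - 1) * μ S =
      ENNReal.ofReal (svf s (wordMap T u) ^ (1 - q) * μ.real S ^ q) := by
  have hq' : 0 ≤ q - 1 := sub_nonneg.2 hq
  calc (invSvf T s u * μ S) ^ (q - 1) * μ S
      = invSvf T s u ^ (q - 1) * (μ S ^ (q - 1) * μ S ^ (1 : ℝ)) := by
        rw [ENNReal.mul_rpow_of_nonneg _ _ hq', ENNReal.rpow_one, mul_assoc]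
    _ = ENNReal.ofReal (svf s (wordMap T u)) ^ (1 - q) * μ S ^ q := by
        rw [← ENNReal.rpow_add_of_nonneg _ _ hq' zero_le_one, sub_add_cancel, invSvf,
          ENNReal.inv_rpow, ← ENNReal.rpow_neg, neg_sub]
    _ = ENNReal.ofReal (svf s (wordMap T u) ^ (1 - q) * μ.real S ^ q) := by
        rw [ENNReal.ofReal_mul (Real.rpow_nonneg hu.le _), ← ENNReal.ofReal_rpow_of_pos hu,
          ← ENNReal.ofReal_rpow_of_nonneg measureReal_nonneg (zero_le_one.trans hq),
          ofReal_measureReal]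

theorem lintegral_invSvf_mul_measure_cyl_rpow [IsFiniteMeasure μ] (hT : ∀ i, (T i).det ≠ 0)
    (hq : 1 ≤ q) (k : ℕ) :
    ∫⁻ x, (invSvf T s (curtail x k) * μ (cyl (curtail x k))) ^ (q - 1) ∂μ =
      ENNReal.ofReal (momentSum T μ s q k) := by
  have hpos := svf_wordMap_pos hT s
  rw [lintegral_comp_curtail μ fun u => (invSvf T s u * μ (cyl u)) ^ (q - 1), momentSum,
    ENNReal.ofReal_sum_of_nonneg fun u _ => mul_nonneg (Real.rpow_nonneg (hpos _).le _)
      (Real.rpow_nonneg measureReal_nonneg _)]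
  exact Finset.sum_congr rfl fun u _ => invSvf_mul_rpow_mul (hpos _) hq _

end MultiEnergy

end AlmostSelfAffine

end

open AlmostSelfAffine in
theorem theorem7p4_general {N m : ℕ}
    (T : Fin m → EuclideanSpace ℝ (Fin N) →L[ℝ] EuclideanSpace ℝ (Fin N))
    (hT : ∀ i, ‖T i‖ ≤ 1) (hT' : ∀ i, (T i).det ≠ 0)
    (μ : Measure (Code m)) [IsFiniteMeasure μ]
    (q : ℝ) (hq : 1 < q) (n : ℕ) (hn : 0 < n) (hn' : (n : ℝ) ≤ q) (s : ℝ)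
    (hdecay : ∃ c r : ℝ, 0 < r ∧ r < 1 ∧ ∀ k : ℕ, momentSum T μ s q k ≤ c * r ^ k) :
    multiEnergy T μ s q n < ⊤ := by
  obtain ⟨c, r, hr₀, hr₁, hcr⟩ := hdecay
  have hp : 0 < q - 1 := sub_pos.2 hq
  have hmoment : ∀ k, ∫⁻ x, (invSvf T s (curtail x k) * μ (cyl (curtail x k))) ^ (q - 1) ∂μ ≤
      ENNReal.ofReal c * ENNReal.ofReal r ^ k := fun k => by
    rw [lintegral_invSvf_mul_measure_cyl_rpow hT' hq.le, ← ENNReal.ofReal_pow hr₀.le,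
      ← ENNReal.ofReal_mul' (pow_nonneg hr₀.le k)]
    exact ENNReal.ofReal_le_ofReal (hcr k)
  have htree : DominatedByPower μ (n * (q - 1)⁻¹)
      (treeIntegral (pathKernel (invSvf T s)) μ n 1) :=
    dominatedByPower_treeIntegral_pathKernel hp ENNReal.ofReal_ne_top
      (ENNReal.ofReal_lt_one.2 hr₁) hmoment (by rwa [sub_add_cancel])
  have hexp : (q - 1) / n = (n * (q - 1)⁻¹)⁻¹ := by rw [mul_inv_rev, inv_inv, div_eq_mul_inv]
  refine (multiEnergy_le_lintegral_treeIntegral hT hT' μ s hq.le n).trans_lt ?_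
  rw [hexp]
  exact htree.lintegral_rpow_inv_lt_top (by positivity)

theorem theorem7p4 {N m : ℕ} (hN : 0 < N)
    (T : Fin m → EuclideanSpace ℝ (Fin N) →L[ℝ] EuclideanSpace ℝ (Fin N))
    (hT : ∀ i, ‖T i‖ < 1) (hT' : ∀ i, (T i).det ≠ 0)
    (μ : MeasureTheory.Measure (AlmostSelfAffine.Code m)) [MeasureTheory.IsFiniteMeasure μ]
    (q : ℝ) (hq : 1 < q) (n : ℕ) (hn : q - 1 ≤ n) (hn' : (n : ℝ) ≤ q)
    (s : ℝ) (hs : 0 < s)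
    (hdecay : ∃ c r : ℝ, 0 < r ∧ r < 1 ∧
      ∀ k : ℕ, AlmostSelfAffine.momentSum T μ s q k ≤ c * r ^ k) :
    AlmostSelfAffine.multiEnergy T μ s q n < ⊤ :=
  theorem7p4_general T (fun i => (hT i).le) hT' μ q hq n
    (Nat.cast_pos.1 ((sub_pos.2 hq).trans_le hn)) hn' s hdecay
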